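/- Let $p$ be a prime and let $R$ be a commutative ring of characteristic $p$ that is $F$-finite, i.e. $R$ is a finite module over its subring $R^{p^e}$ of $p^e$-th powers for every $e\in\mathbb N$. Let $f_1,\dots,f_r\in R$ be elements whose product $\mathbf f=f_1\cdots f_r$ is a non-zero divisor, and let $R_{\mathbf f}$ be the localization of $R$ at $\mathbf f$. For $\mathbf a\in\mathbb Z^r$ write $\mathbf f^{\mathbf a}=f_1^{a_1}\cdots f_r^{a_r}\in R_{\mathbf f}$. For an $\mathbb F_p$-algebra $T$ let $C(\mathbb Z_p^r,T)$ be the ring of continuous maps $\mathbb Z_p^r\to T$, $T$ being discrete, with pointwise operations. For a commutative $\mathbb F_p$-algebra $A$ let $D_A$ be the ring of $\mathbb F_p$-linear differential operators of finite order on $A$; $A\subseteq D_A$ acts by multiplication. Let $C(\mathbb Z_p^r,R_{\mathbf f})\,f_1^{s_1}\cdots f_r^{s_r}$ be the free $C(\mathbb Z_p^r,R_{\mathbf f})$-module of rank one on the formal symbol $f_1^{s_1}\cdots f_r^{s_r}$. For $\mathbf a\in\mathbb Z^r$ let $E_{\mathbf a}$ be the specialization map from it to $R_{\mathbf f}$ given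 by $E_{\mathbf a}(U f_1^{s_1}\cdots f_r^{s_r})=U(\mathbf a)\,\mathbf f^{\mathbf a}$. Put $A=R_{\mathbf f}[t_1,\dots,t_r]$ and $g_i=f_i-t_i$, and let $$H'=H^r_{(g_1,\dots,g_r)}A=A_{g_1\cdots g_r}\Big/\sum_{i=1}^r\operatorname{im}\big(A_{\prod_{j\ne i}g_j}\to A_{g_1\cdots g_r}\big),\qquad \delta'=\Big[\frac1{g_1\cdots g_r}\Big]\in H'.$$ It is a $D_A$-module: if $\varphi\in D_A$ is linear over the $p^e$-th powers of $A$ (every $\varphi\in D_A$ is, for some $e$), then $\varphi$ acts by $\varphi\cdot[x/s]=[\varphi(s^{p^e-1}x)/s^{p^e}]$, where $x\in A$ and $s$ is a power of $g_1\cdots g_r$. Let $$\Delta:C(\mathbb Z_p^r,D_{R_{\mathbf f}})\to D_A,\qquad \Delta(P)(u\,\mathbf t^{\mathbf a})=P(-\mathbf a-(1,\dots,1))(u)\,\mathbf t^{\mathbf a}\quad(u\in R_{\mathbf f},\ \mathbf a\in\mathbb N^r),$$ which is a ring homomorphism, and regard $H'$ as a $C(\mathbb Z_p^r,D_{R_{\mathbf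 f}})$-module through $\Delta$. Then $C(\mathbb Z_p^r,R_{\mathbf f})\,f_1^{s_1}\cdots f_r^{s_r}$ admits a $C(\mathbb Z_p^r,D_{R_{\mathbf f}})$-module structure that is compatible with all exponent specializations, i.e. $$E_{\mathbf a}\big(P\cdot U f_1^{s_1}\cdots f_r^{s_r}\big)=P(\mathbf a)\big(E_{\mathbf a}(U f_1^{s_1}\cdots f_r^{s_r})\big)$$ for all $\mathbf a\in\mathbb Z^r$, $P\in C(\mathbb Z_p^r,D_{R_{\mathbf f}})$ and $U\in C(\mathbb Z_p^r,R_{\mathbf f})$, and such that, with this structure, the map $$\Theta:C(\mathbb Z_p^r,R_{\mathbf f})\,f_1^{s_1}\cdots f_r^{s_r}\to H',\qquad U f_1^{s_1}\cdots f_r^{s_r}\mapsto\Delta(U)\cdot\delta'$$ is an isomorphism of $C(\mathbb Z_p^r,D_{R_{\mathbf f}})$-modules. -/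

import Mathlib

noncomputable section

namespace BSTheory

/-! ### F-finite rings -/

/-- A ring `R` of characteristic `p` is `F`-finite if, for every `e`, it is a finite module over its
subring of `p ^ e`-th powers, i.e. the `e`-th iterate of the Frobenius is a finite ring map. -/
def IsFFinite (p : ℕ) [Fact p.Prime] (R : Type*) [CommRing R] [CharP R p] : Prop :=
  ∀ e : ℕ, (iterateFrobenius R p e).Finite

/-! ### Differential operators -/

section DiffOp

variable {k A : Type*} [CommRing k] [CommRing A] [Algebra k A]

/-- The commutator `[φ, x] = φ ∘ x - x ∘ φ` of a `k`-linear endomorphism `φ` of `A` with the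
multiplication by `x`. -/
def bracket (φ : Module.End k A) (x : A) : Module.End k A :=
  φ * LinearMap.mulLeft k x - LinearMap.mulLeft k x * φ

/-- `φ` is a `k`-linear differential operator on `A` of order at most `n`. -/
def IsDiffOp : ℕ → Module.End k A → Prop
  | 0, φ => ∀ x y : A, φ (x * y) = x * φ y
  | n + 1, φ => ∀ x : A, IsDiffOp n (bracket φ x)

theorem bracket_apply (φ : Module.End k A) (x y : A) :
    bracket φ x y = φ (x * y) - x * φ y := by
  simp [bracket]

theorem bracket_add (φ ψ : Module.End k A) (x : A) :
    bracket (φ + ψ) x = bracket φ x + bracket ψ x := by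
  ext y; simp only [bracket_apply, LinearMap.add_apply]; ring

theorem bracket_mul (φ ψ : Module.End k A) (x : A) :
    bracket (φ * ψ) x = φ * bracket ψ x + bracket φ x * ψ := by
  ext y; simp [bracket_apply]

theorem bracket_zero (x : A) : bracket (0 : Module.End k A) x = 0 := by
  ext y; simp [bracket_apply]

theorem bracket_bracket (φ : Module.End k A) (x y : A) :
    bracket (bracket φ x) y = bracket (bracket φ y) x := by
  ext z; simp only [bracket_apply]
  rw [mul_left_comm x y z]; ring

theorem bracket_mulLeft_mul (φ : Module.End k A) (a x : A) :
    bracket (LinearMap.mulLeft k a * φ) x = LinearMap.mulLeft k a * bracket φ x := by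
  ext z; simp only [bracket_apply, Module.End.mul_apply, LinearMap.mulLeft_apply]; ring

theorem bracket_mul_mulLeft (φ : Module.End k A) (a x : A) :
    bracket (φ * LinearMap.mulLeft k a) x = bracket φ x * LinearMap.mulLeft k a := by
  ext z; simp only [bracket_apply, Module.End.mul_apply, LinearMap.mulLeft_apply]
  rw [mul_left_comm a x z]

/-- Auxiliary: "order less than `n`". -/
def IsDiffOpLT : ℕ → Module.End k A → Prop
  | 0, φ => φ = 0
  | n + 1, φ => ∀ x : A, IsDiffOpLT n (bracket φ x)

theorem isDiffOp_iff_lt (n : ℕ) (φ : Module.End k A) : IsDiffOp n φ ↔ IsDiffOpLT (n + 1) φ := by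
  induction n generalizing φ with
  | zero =>
    constructor
    · intro h x; ext y; simp [bracket_apply, h x y]
    · intro h x y
      have := congrArg (fun T : Module.End k A => T y) (h x)
      simpa [bracket_apply, sub_eq_zero] using this
  | succ n ih => exact forall_congr' fun x => ih _

theorem IsDiffOpLT.zero (n : ℕ) : IsDiffOpLT n (0 : Module.End k A) := by
  induction n with
  | zero => rfl
  | succ n ih => intro x; rw [bracket_zero]; exact ih

theorem IsDiffOpLT.succ {n : ℕ} {φ : Module.End k A} (h : IsDiffOpLT n φ) :
    IsDiffOpLT (n + 1) φ := by
  induction n generalizing φ with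
  | zero => rw [show φ = 0 from h]; exact IsDiffOpLT.zero _
  | succ n ih => intro x; exact ih (h x)

theorem IsDiffOpLT.mono {m n : ℕ} (hmn : m ≤ n) {φ : Module.End k A} (h : IsDiffOpLT m φ) :
    IsDiffOpLT n φ := by
  induction hmn with
  | refl => exact h
  | step _ ih => exact ih.succ

theorem IsDiffOpLT.add {n : ℕ} {φ ψ : Module.End k A} (h : IsDiffOpLT n φ)
    (h' : IsDiffOpLT n ψ) : IsDiffOpLT n (φ + ψ) := by
  induction n generalizing φ ψ with
  | zero => rw [show φ = 0 from h, show ψ = 0 from h', add_zero]; rfl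
  | succ n ih => intro x; rw [bracket_add]; exact ih (h x) (h' x)

theorem IsDiffOpLT.mul {m n : ℕ} {φ ψ : Module.End k A} (h : IsDiffOpLT m φ)
    (h' : IsDiffOpLT n ψ) : IsDiffOpLT (m + n) (φ * ψ) := by
  induction hN : m + n generalizing m n φ ψ with
  | zero =>
    obtain rfl : m = 0 := by omega
    rw [show φ = 0 from h, zero_mul]; rfl
  | succ N ih =>
    rcases m with _ | m
    · rw [show φ = 0 from h, zero_mul]; exact IsDiffOpLT.zero _
    rcases n with _ | n
    · rw [show ψ = 0 from h', mul_zero]; exact IsDiffOpLT.zero _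
    intro x
    rw [bracket_mul]
    exact (ih h (h' x) (by omega)).add (ih (h x) h' (by omega))

theorem IsDiffOpLT.mulLeft_mul {n : ℕ} {φ : Module.End k A} (h : IsDiffOpLT n φ) (a : A) :
    IsDiffOpLT n (LinearMap.mulLeft k a * φ) := by
  induction n generalizing φ with
  | zero => rw [show φ = 0 from h, mul_zero]; rfl
  | succ n ih => intro x; rw [bracket_mulLeft_mul]; exact ih (h x)

theorem IsDiffOpLT.mul_mulLeft {n : ℕ} {φ : Module.End k A} (h : IsDiffOpLT n φ) (a : A) :
    IsDiffOpLT n (φ * LinearMap.mulLeft k a) := by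
  induction n generalizing φ with
  | zero => rw [show φ = 0 from h, zero_mul]; rfl
  | succ n ih => intro x; rw [bracket_mul_mulLeft]; exact ih (h x)

theorem isDiffOpLT_mulLeft (a : A) : IsDiffOpLT 1 (LinearMap.mulLeft k a) := by
  intro x
  change bracket _ _ = 0
  ext y; simp only [bracket_apply, LinearMap.mulLeft_apply, LinearMap.zero_apply]; ring

variable (k A) in
/-- The ring `D_{A/k}` of `k`-linear differential operators on `A`. -/
def DiffOp : Subalgebra k (Module.End k A) where
  carrier := {φ | ∃ n, IsDiffOp n φ}
  mul_mem' := by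
    rintro φ ψ ⟨m, hm⟩ ⟨n, hn⟩
    rw [isDiffOp_iff_lt] at hm hn
    exact ⟨m + 1 + (n + 1), (isDiffOp_iff_lt _ _).2 (hm.mul hn).succ⟩
  add_mem' := by
    rintro φ ψ ⟨m, hm⟩ ⟨n, hn⟩
    rw [isDiffOp_iff_lt] at hm hn
    refine ⟨max m n, (isDiffOp_iff_lt _ _).2 ?_⟩
    exact (hm.mono (by omega)).add (hn.mono (by omega))
  algebraMap_mem' := by
    intro c
    exact ⟨0, fun x y => by simp [Module.algebraMap_end_apply]⟩

variable (k) in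
/-- The inclusion `A = D^0_{A/k} ⊆ D_{A/k}`: an element acts by multiplication. -/
def DiffOp.ofMul : A →+* DiffOp k A where
  toFun a := ⟨LinearMap.mulLeft k a, 0, fun x y => by simp [mul_left_comm]⟩
  map_one' := by ext; simp
  map_mul' a b := by ext; simp
  map_zero' := by ext; simp
  map_add' a b := by ext; simp [add_mul]

theorem DiffOp.exists_lt (φ : DiffOp k A) : ∃ n, IsDiffOpLT n (φ : Module.End k A) := by
  obtain ⟨n, hn⟩ := φ.2
  exact ⟨n + 1, (isDiffOp_iff_lt _ _).1 hn⟩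

/-- `[·, x]` as a linear operator on `End_k(A)`. -/
def bracketHom (x : A) : Module.End k (Module.End k A) :=
  LinearMap.mulRight k (LinearMap.mulLeft k x) - LinearMap.mulLeft k (LinearMap.mulLeft k x)

theorem bracketHom_apply (x : A) (φ : Module.End k A) : bracketHom x φ = bracket φ x := by
  simp [bracketHom, bracket]

theorem IsDiffOpLT.bracketHom_pow {n : ℕ} {φ : Module.End k A} (h : IsDiffOpLT n φ) (x : A) :
    (bracketHom x ^ n) φ = 0 := by
  induction n generalizing φ with
  | zero => exact h
  | succ n ih => rw [pow_succ, Module.End.mul_apply, bracketHom_apply]; exact ih (h x)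

end DiffOp

/-! ### Differential operators in characteristic `p` -/

section CharP

variable {p : ℕ} [Fact p.Prime] {A : Type*} [CommRing A] [Algebra (ZMod p) A]

theorem bracketHom_pow_char (x : A) (e : ℕ) :
    (bracketHom x ^ p ^ e : Module.End (ZMod p) (Module.End (ZMod p) A))
      = bracketHom (x ^ p ^ e) := by
  have hp : (p : Module.End (ZMod p) (Module.End (ZMod p) A)) = 0 := by
    rw [← map_natCast (algebraMap (ZMod p) (Module.End (ZMod p) (Module.End (ZMod p) A)))]
    simp
  set a : Module.End (ZMod p) A := LinearMap.mulLeft (ZMod p) x with ha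
  have h1 : bracketHom x + LinearMap.mulLeft (ZMod p) a = LinearMap.mulRight (ZMod p) a := by
    refine LinearMap.ext fun T => ?_
    simp [bracketHom, ha]
  have h2 : Commute (bracketHom x) (LinearMap.mulLeft (ZMod p) a) := by
    refine LinearMap.ext fun T => ?_
    simp [bracketHom, ha, mul_sub, mul_assoc]
  obtain ⟨r, hr⟩ := h2.exists_add_pow_prime_pow_eq (Fact.out : p.Prime) e
  rw [hp, zero_mul, zero_mul, zero_mul, add_zero, h1, LinearMap.pow_mulRight,
    LinearMap.pow_mulLeft, ha, LinearMap.pow_mulLeft] at hr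
  refine LinearMap.ext fun T => ?_
  have hT := LinearMap.congr_fun hr T
  rw [bracketHom_apply, bracket]
  refine eq_sub_of_add_eq (Eq.trans ?_ hT.symm)
  rw [LinearMap.add_apply, LinearMap.pow_mulLeft]
  rfl

/-- `φ` is a differential operator of level `e`: it is linear over the `p ^ e`-th powers. -/
def IsLevel (e : ℕ) (φ : Module.End (ZMod p) A) : Prop :=
  ∀ x y : A, φ (x ^ p ^ e * y) = x ^ p ^ e * φ y

theorem IsLevel.mono {e e' : ℕ} (h : e ≤ e') {φ : Module.End (ZMod p) A} (hφ : IsLevel e φ) :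
    IsLevel e' φ := by
  obtain ⟨d, rfl⟩ := Nat.exists_eq_add_of_le' h
  intro x y
  rw [pow_add, pow_mul]
  exact hφ _ _

theorem DiffOp.exists_level (φ : DiffOp (ZMod p) A) :
    ∃ e, IsLevel e (φ : Module.End (ZMod p) A) := by
  obtain ⟨n, hn⟩ := DiffOp.exists_lt φ
  refine ⟨n, fun x y => ?_⟩
  have hn' := hn.mono (Nat.lt_pow_self (Fact.out : p.Prime).one_lt (n := n)).le
  have := hn'.bracketHom_pow x
  rw [bracketHom_pow_char, bracketHom_apply] at this
  have := congrArg (fun T : Module.End (ZMod p) A => T y) this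
  simpa [bracket_apply, sub_eq_zero] using this

/-! ### The action of differential operators on localizations -/

section Localization

variable (M : Submonoid A) {L : Type*} [CommRing L] [Algebra A L] [IsLocalization M L]

/-- The action of a differential operator `φ` on a localization of `A`: if `φ` is linear over the
`p ^ e`-th powers then `φ (x / s) = φ (s ^ (p ^ e - 1) x) / s ^ (p ^ e)`. -/
def extLoc (φ : DiffOp (ZMod p) A) (y : L) : L :=
  let e := (DiffOp.exists_level φ).choose
  let x := (IsLocalization.sec M y).1
  let s := (IsLocalization.sec M y).2
  IsLocalization.mk' L ((φ : Module.End (ZMod p) A) ((s : A) ^ (p ^ e - 1) * x)) (s ^ p ^ e)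

theorem map_congr_of_isLevel (M : Submonoid A) {L : Type*} [CommRing L] [Algebra A L]
    [IsLocalization M L] {e : ℕ} {φ : Module.End (ZMod p) A} (h : IsLevel e φ) {a b : A}
    (hab : algebraMap A L a = algebraMap A L b) :
    algebraMap A L (φ a) = algebraMap A L (φ b) := by
  obtain ⟨c, hc⟩ := (IsLocalization.eq_iff_exists M L).1 hab
  refine (IsLocalization.eq_iff_exists M L).2 ⟨c ^ p ^ e, ?_⟩
  have hpos : 0 < p ^ e := Nat.pow_pos (Fact.out : p.Prime).pos
  rw [SubmonoidClass.coe_pow, ← h, ← h]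
  congr 1
  rw [← Nat.sub_add_cancel hpos, pow_succ, mul_assoc, mul_assoc, hc]

theorem extLoc_spec (φ : DiffOp (ZMod p) A) {e : ℕ} (he : IsLevel e (φ : Module.End (ZMod p) A))
    {y : L} {s x : A} (hs : s ∈ M) (h : algebraMap A L (s ^ p ^ e) * y = algebraMap A L x) :
    algebraMap A L (s ^ p ^ e) * extLoc M φ y =
      algebraMap A L ((φ : Module.End (ZMod p) A) x) := by
  have hpp : p.Prime := Fact.out
  obtain ⟨e₀, he₀, x₀, s₀, hy, hext⟩ : ∃ e₀, IsLevel e₀ (φ : Module.End (ZMod p) A) ∧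
      ∃ (x₀ : A) (s₀ : M), y * algebraMap A L s₀ = algebraMap A L x₀ ∧
      extLoc M φ y = IsLocalization.mk' L
        ((φ : Module.End (ZMod p) A) ((s₀ : A) ^ (p ^ e₀ - 1) * x₀)) (s₀ ^ p ^ e₀) :=
    ⟨_, (DiffOp.exists_level φ).choose_spec, _, _, IsLocalization.sec_spec M y, rfl⟩
  set F := (φ : Module.End (ZMod p) A)
  have hpos : ∀ d, 0 < p ^ d := fun d => Nat.pow_pos hpp.pos
  -- a common level
  set E := e + e₀ with hE
  have hEe : p ^ E = p ^ e₀ * p ^ e := by rw [hE, pow_add, mul_comm]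
  have hEe₀ : p ^ E = p ^ e * p ^ e₀ := by rw [hE, pow_add]
  have heE : IsLevel E F := he.mono (by omega)
  obtain ⟨m, hm⟩ : ∃ m, p ^ e₀ = m + 1 := ⟨p ^ e₀ - 1, (Nat.sub_add_cancel (hpos _)).symm⟩
  obtain ⟨n, hn⟩ : ∃ n, p ^ e = n + 1 := ⟨p ^ e - 1, (Nat.sub_add_cancel (hpos _)).symm⟩
  have key : algebraMap A L (F (s ^ p ^ E * (((s₀ : A) ^ n) ^ p ^ e₀ *
      ((s₀ : A) ^ (p ^ e₀ - 1) * x₀))))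
      = algebraMap A L (F ((s₀ : A) ^ p ^ E * ((s ^ m) ^ p ^ e * x))) := by
    apply map_congr_of_isLevel M heE
    simp only [map_mul, ← hy, ← h]
    simp only [← map_mul, mul_comm y, ← mul_assoc]
    congr 2
    rw [hEe, hm, hn]; simp only [Nat.add_sub_cancel]; ring
  rw [heE, heE, he₀, he] at key
  have hu : IsUnit (algebraMap A L ((s ^ m) ^ p ^ e * (s₀ : A) ^ p ^ E)) := by
    apply IsLocalization.map_units L (⟨_, M.mul_mem (M.pow_mem (M.pow_mem hs _) _)
      (M.pow_mem s₀.2 _)⟩ : M)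
  apply hu.mul_left_cancel
  have hk : IsLocalization.mk' L (F ((s₀ : A) ^ (p ^ e₀ - 1) * x₀)) (s₀ ^ p ^ e₀) *
      algebraMap A L ((s₀ : A) ^ p ^ e₀) =
      algebraMap A L (F ((s₀ : A) ^ (p ^ e₀ - 1) * x₀)) := by
    have := IsLocalization.mk'_spec L (F ((s₀ : A) ^ (p ^ e₀ - 1) * x₀)) (s₀ ^ p ^ e₀)
    simpa using this
  rw [hext]
  calc _ = algebraMap A L (s ^ p ^ E) * (algebraMap A L (((s₀ : A) ^ n) ^ p ^ e₀) *
        (IsLocalization.mk' L (F ((s₀ : A) ^ (p ^ e₀ - 1) * x₀)) (s₀ ^ p ^ e₀) *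
          algebraMap A L ((s₀ : A) ^ p ^ e₀))) := by
        simp only [map_mul, map_pow]
        rw [hEe, hm, hn]; ring
    _ = _ := by
        rw [hk, ← map_mul, ← map_mul, key, ← map_mul]
        congr 1; ring

theorem extLoc_algebraMap (φ : DiffOp (ZMod p) A) (x : A) :
    extLoc M φ (algebraMap A L x) = algebraMap A L ((φ : Module.End (ZMod p) A) x) := by
  obtain ⟨e, he⟩ := DiffOp.exists_level φ
  simpa using extLoc_spec M φ he (y := algebraMap A L x) (x := x) M.one_mem (by simp)

theorem exists_rep (q : ℕ) (hq : 0 < q) (y : L) : ∃ s ∈ M, ∃ x : A,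
    algebraMap A L (s ^ q) * y = algebraMap A L x := by
  obtain ⟨⟨x, s⟩, h⟩ := IsLocalization.surj M y
  refine ⟨s, s.2, s ^ (q - 1) * x, ?_⟩
  rw [map_mul, ← h, ← Nat.sub_add_cancel hq, pow_succ]
  simp only [Nat.add_sub_cancel, map_mul]
  ring

theorem extLoc_pow_mul (φ : DiffOp (ZMod p) A) {e : ℕ}
    (he : IsLevel e (φ : Module.End (ZMod p) A)) (a : A) (y : L) :
    extLoc M φ (algebraMap A L (a ^ p ^ e) * y) = algebraMap A L (a ^ p ^ e) * extLoc M φ y := by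
  obtain ⟨s, hs, x, hx⟩ := exists_rep M (p ^ e) (Nat.pow_pos (Fact.out : p.Prime).pos) y
  have hu : IsUnit (algebraMap A L (s ^ p ^ e)) :=
    IsLocalization.map_units L (⟨_, M.pow_mem hs _⟩ : M)
  apply hu.mul_left_cancel
  rw [extLoc_spec M φ he (x := a ^ p ^ e * x) hs (by rw [map_mul, ← hx]; ring), he, map_mul,
    ← extLoc_spec M φ he hs hx]
  ring

theorem eq_of_pow_mul_eq {y z : L} {q : ℕ} {s : A} (hs : s ∈ M)
    (h : algebraMap A L (s ^ q) * y = algebraMap A L (s ^ q) * z) : y = z :=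
  (IsLocalization.map_units L (⟨_, M.pow_mem hs q⟩ : M)).mul_left_cancel h

theorem extLoc_add (φ : DiffOp (ZMod p) A) (y z : L) :
    extLoc M φ (y + z) = extLoc M φ y + extLoc M φ z := by
  obtain ⟨e, he⟩ := DiffOp.exists_level φ
  have hpos : 0 < p ^ e := Nat.pow_pos (Fact.out : p.Prime).pos
  obtain ⟨s, hs, x, hx⟩ := exists_rep M (p ^ e) hpos y
  obtain ⟨t, ht, w, hw⟩ := exists_rep M (p ^ e) hpos z
  have hx' : algebraMap A L ((s * t) ^ p ^ e) * y = algebraMap A L (t ^ p ^ e * x) := by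
    rw [mul_pow, map_mul, map_mul, ← hx]; ring
  have hw' : algebraMap A L ((s * t) ^ p ^ e) * z = algebraMap A L (s ^ p ^ e * w) := by
    rw [mul_pow, map_mul, map_mul, ← hw]; ring
  have hst : s * t ∈ M := M.mul_mem hs ht
  apply eq_of_pow_mul_eq M hst (q := p ^ e)
  rw [mul_add, extLoc_spec M φ he hst hx', extLoc_spec M φ he hst hw',
    extLoc_spec M φ he hst (x := t ^ p ^ e * x + s ^ p ^ e * w) (by rw [mul_add, hx', hw', map_add]),
    map_add, map_add]

theorem extLoc_op_add (φ ψ : DiffOp (ZMod p) A) (y : L) :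
    extLoc M (φ + ψ) y = extLoc M φ y + extLoc M ψ y := by
  obtain ⟨e₁, he₁⟩ := DiffOp.exists_level φ
  obtain ⟨e₂, he₂⟩ := DiffOp.exists_level ψ
  obtain ⟨e₃, he₃⟩ := DiffOp.exists_level (φ + ψ)
  set e := e₁ + e₂ + e₃
  obtain ⟨s, hs, x, hx⟩ := exists_rep M (p ^ e) (Nat.pow_pos (Fact.out : p.Prime).pos) y
  apply eq_of_pow_mul_eq M hs (q := p ^ e)
  rw [mul_add, extLoc_spec M φ (he₁.mono (by omega)) hs hx,
    extLoc_spec M ψ (he₂.mono (by omega)) hs hx,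
    extLoc_spec M (φ + ψ) (he₃.mono (by omega)) hs hx, ← map_add]
  rfl

theorem extLoc_op_mul (φ ψ : DiffOp (ZMod p) A) (y : L) :
    extLoc M (φ * ψ) y = extLoc M φ (extLoc M ψ y) := by
  obtain ⟨e₁, he₁⟩ := DiffOp.exists_level φ
  obtain ⟨e₂, he₂⟩ := DiffOp.exists_level ψ
  obtain ⟨e₃, he₃⟩ := DiffOp.exists_level (φ * ψ)
  set e := e₁ + e₂ + e₃
  obtain ⟨s, hs, x, hx⟩ := exists_rep M (p ^ e) (Nat.pow_pos (Fact.out : p.Prime).pos) y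
  apply eq_of_pow_mul_eq M hs (q := p ^ e)
  rw [extLoc_spec M (φ * ψ) (he₃.mono (by omega)) hs hx,
    extLoc_spec M φ (he₁.mono (by omega)) hs (extLoc_spec M ψ (he₂.mono (by omega)) hs hx)]
  rfl

theorem extLoc_op_one (y : L) : extLoc M (1 : DiffOp (ZMod p) A) y = y := by
  obtain ⟨e, he⟩ := DiffOp.exists_level (1 : DiffOp (ZMod p) A)
  obtain ⟨s, hs, x, hx⟩ := exists_rep M (p ^ e) (Nat.pow_pos (Fact.out : p.Prime).pos) y
  apply eq_of_pow_mul_eq M hs (q := p ^ e)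
  rw [extLoc_spec M 1 he hs hx, hx]
  rfl

variable (L) in
/-- A localization `L` of `A` is a `D_A`-module. -/
def extLocHom : DiffOp (ZMod p) A →+* AddMonoid.End L where
  toFun φ := AddMonoidHom.mk' (extLoc M φ) (extLoc_add M φ)
  map_one' := by ext y; exact extLoc_op_one M y
  map_mul' φ ψ := by ext y; exact extLoc_op_mul M φ ψ y
  map_zero' := by
    ext y
    have := extLoc_op_add M (0 : DiffOp (ZMod p) A) 0 y
    rw [add_zero] at this
    exact left_eq_add.1 this
  map_add' φ ψ := by ext y; exact extLoc_op_add M φ ψ y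

end Localization

end CharP

/-! ### Top local cohomology -/

section Cech

variable {p : ℕ} [Fact p.Prime] {A : Type*} [CommRing A] [Algebra (ZMod p) A]
variable {r : ℕ}

/-- The localization map `A_{∏_{j ≠ i} g_j} → A_{∏_j g_j}`. -/
def cechMap (g : Fin r → A) (i : Fin r) :
    Localization.Away (∏ j ∈ Finset.univ.erase i, g j) →ₐ[A] Localization.Away (∏ j, g j) :=
  IsLocalization.liftAlgHom (M := Submonoid.powers (∏ j ∈ Finset.univ.erase i, g j))
    (f := Algebra.ofId A (Localization.Away (∏ j, g j))) (by
      rintro ⟨_, n, rfl⟩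
      rw [Algebra.ofId_apply, map_pow]
      refine IsUnit.pow _ (isUnit_of_dvd_unit (map_dvd _ ?_)
        (IsLocalization.Away.algebraMap_isUnit (∏ j, g j)))
      exact Finset.prod_dvd_prod_of_subset _ _ _ (Finset.erase_subset _ _))

/-- The image of `⨁_i A_{∏_{j ≠ i} g_j} → A_{∏_j g_j}`. -/
def cechImage (g : Fin r → A) : Submodule A (Localization.Away (∏ j, g j)) :=
  ⨆ i, LinearMap.range (cechMap g i).toLinearMap

/-- The local cohomology module `H^r_{(g_1, …, g_r)} A`: the cokernel of
`⨁_i A_{∏_{j ≠ i} g_j} → A_{g_1 ⋯ g_r}`. -/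
def TopLocCoh (g : Fin r → A) : Type _ := Localization.Away (∏ j, g j) ⧸ cechImage g

instance (g : Fin r → A) : AddCommGroup (TopLocCoh g) :=
  inferInstanceAs (AddCommGroup (Localization.Away (∏ j, g j) ⧸ cechImage g))

instance (g : Fin r → A) : Module A (TopLocCoh g) :=
  inferInstanceAs (Module A (Localization.Away (∏ j, g j) ⧸ cechImage g))

/-- The class in `H^r_{(g_1, …, g_r)} A` of an element of `A_{g_1 ⋯ g_r}`. -/
def TopLocCoh.mk (g : Fin r → A) : Localization.Away (∏ j, g j) →ₗ[A] TopLocCoh g :=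
  (cechImage g).mkQ

/-- The class of `1 / (g_1 ⋯ g_r)`. -/
def TopLocCoh.delta (g : Fin r → A) : TopLocCoh g :=
  TopLocCoh.mk g (IsLocalization.Away.invSelf (∏ j, g j))

theorem extLocHom_mem_cechImage (g : Fin r → A) (φ : DiffOp (ZMod p) A)
    {y : Localization.Away (∏ j, g j)} (hy : y ∈ cechImage g) :
    extLocHom (Submonoid.powers (∏ j, g j)) (Localization.Away (∏ j, g j)) φ y ∈ cechImage g := by
  induction hy using Submodule.iSup_induction' with
  | zero => rw [map_zero]; exact zero_mem _
  | add y z _ _ hy hz => rw [map_add]; exact add_mem hy hz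
  | mem i y hy =>
    obtain ⟨z, rfl⟩ := hy
    refine Submodule.mem_iSup_of_mem i ?_
    obtain ⟨e, he⟩ := DiffOp.exists_level φ
    obtain ⟨s, hs, x, hx⟩ := exists_rep
      (Submonoid.powers (∏ j ∈ Finset.univ.erase i, g j)) (p ^ e)
      (Nat.pow_pos (Fact.out : p.Prime).pos) z
    have hu : IsUnit (algebraMap A (Localization.Away (∏ j ∈ Finset.univ.erase i, g j))
        (s ^ p ^ e)) :=
      IsLocalization.map_units _ (⟨_, Submonoid.pow_mem _ hs _⟩ :
        Submonoid.powers (∏ j ∈ Finset.univ.erase i, g j))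
    obtain ⟨w, hw⟩ := hu.exists_right_inv
    refine ⟨w * algebraMap A _ ((φ : Module.End (ZMod p) A) x), ?_⟩
    have hu' := hu.map (cechMap g i)
    rw [AlgHom.commutes] at hu'
    apply hu'.mul_left_cancel
    have h1 := congrArg (cechMap g i) hx
    rw [map_mul, AlgHom.commutes, AlgHom.commutes] at h1
    have h2 := congrArg (cechMap g i) hw
    rw [map_mul, AlgHom.commutes, map_one] at h2
    have h3 := extLoc_pow_mul (Submonoid.powers (∏ j, g j)) φ he s (cechMap g i z)
    rw [h1, extLoc_algebraMap] at h3
    rw [AlgHom.toLinearMap_apply, map_mul, AlgHom.commutes, ← mul_assoc, h2, one_mul, h3]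
    rfl

/-- The action of `D_A` on `H^r_{(g_1, …, g_r)} A`, induced by the action on `A_{g_1 ⋯ g_r}`. -/
def TopLocCoh.actHom (g : Fin r → A) : DiffOp (ZMod p) A →+* AddMonoid.End (TopLocCoh g) where
  toFun φ := QuotientAddGroup.map (cechImage g).toAddSubgroup (cechImage g).toAddSubgroup
    (extLocHom (Submonoid.powers (∏ j, g j)) (Localization.Away (∏ j, g j)) φ)
    (fun _ hy => extLocHom_mem_cechImage g φ hy)
  map_one' := by
    refine AddMonoidHom.ext fun x => ?_
    obtain ⟨y, rfl⟩ := Submodule.Quotient.mk_surjective _ x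
    exact congrArg (TopLocCoh.mk g) (by rw [map_one]; rfl)
  map_mul' φ ψ := by
    refine AddMonoidHom.ext fun x => ?_
    obtain ⟨y, rfl⟩ := Submodule.Quotient.mk_surjective _ x
    exact congrArg (TopLocCoh.mk g) (by rw [map_mul]; rfl)
  map_zero' := by
    refine AddMonoidHom.ext fun x => ?_
    obtain ⟨y, rfl⟩ := Submodule.Quotient.mk_surjective _ x
    exact (congrArg (TopLocCoh.mk g) (by rw [map_zero]; rfl)).trans (map_zero (TopLocCoh.mk g))
  map_add' φ ψ := by
    refine AddMonoidHom.ext fun x => ?_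
    obtain ⟨y, rfl⟩ := Submodule.Quotient.mk_surjective _ x
    exact congrArg (TopLocCoh.mk g) (by rw [map_add]; rfl)

instance (g : Fin r → A) : Module (DiffOp (ZMod p) A) (TopLocCoh g) :=
  Module.compHom _ (TopLocCoh.actHom g)

theorem TopLocCoh.smul_mk (g : Fin r → A) (φ : DiffOp (ZMod p) A)
    (y : Localization.Away (∏ j, g j)) :
    φ • TopLocCoh.mk g y = TopLocCoh.mk g (extLoc (Submonoid.powers (∏ j, g j)) φ y) :=
  rfl

end Cech

/-! ### Continuous functions on `ℤ_p ^ r` -/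

/-- The ring `C(ℤ_p ^ r, T)` of continuous maps from `ℤ_p ^ r` to the discrete ring `T`, i.e. of
locally constant maps, with pointwise operations. -/
abbrev CZp (p : ℕ) [Fact p.Prime] (r : ℕ) (T : Type*) : Type _ :=
  LocallyConstant (Fin r → ℤ_[p]) T

section Delta

variable {p : ℕ} [Fact p.Prime] {r : ℕ} {B : Type*} [CommRing B] [Algebra (ZMod p) B]

/-- The point `-a - (1, …, 1)` of `ℤ_p ^ r`. -/
def negSubOne (p : ℕ) [Fact p.Prime] {r : ℕ} (a : Fin r →₀ ℕ) : Fin r → ℤ_[p] :=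
  fun i => -(a i : ℤ_[p]) - 1

open MvPolynomial

/-- The operator `u t^a ↦ P(-a - 1)(u) t^a` on `B[t_1, …, t_r]`. -/
def deltaOp (P : CZp p r (DiffOp (ZMod p) B)) : Module.End (ZMod p) (MvPolynomial (Fin r) B) where
  toFun q := ∑ a ∈ q.support,
    monomial a ((P (negSubOne p a) : Module.End (ZMod p) B) (q.coeff a))
  map_add' q q' := by
    ext m
    have key : ∀ q : MvPolynomial (Fin r) B, coeff m (∑ a ∈ q.support,
        monomial a ((P (negSubOne p a) : Module.End (ZMod p) B) (q.coeff a))) =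
        (P (negSubOne p m) : Module.End (ZMod p) B) (q.coeff m) := by
      intro q
      simp only [coeff_sum, coeff_monomial, Finset.sum_ite_eq', mem_support_iff]
      split_ifs <;> simp_all
    rw [coeff_add, key, key, key, coeff_add, map_add]
  map_smul' c q := by
    ext m
    simp only [coeff_smul, coeff_sum, coeff_monomial, Finset.sum_ite_eq', mem_support_iff,
      RingHom.id_apply, map_smul]
    split_ifs <;> simp_all

theorem coeff_deltaOp (P : CZp p r (DiffOp (ZMod p) B)) (q : MvPolynomial (Fin r) B)
    (a : Fin r →₀ ℕ) : (deltaOp P q).coeff a =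
      (P (negSubOne p a) : Module.End (ZMod p) B) (q.coeff a) := by
  simp only [deltaOp, LinearMap.coe_mk, AddHom.coe_mk, coeff_sum, coeff_monomial,
    Finset.sum_ite_eq', mem_support_iff]
  split_ifs <;> simp_all

theorem deltaOp_monomial (P : CZp p r (DiffOp (ZMod p) B)) (a : Fin r →₀ ℕ) (u : B) :
    deltaOp P (monomial a u) =
      monomial a ((P (negSubOne p a) : Module.End (ZMod p) B) u) := by
  classical
  ext m
  rw [coeff_deltaOp, coeff_monomial, coeff_monomial]
  split_ifs with h
  · rw [h]
  · simp

/-- An operator on `B[t]` all of whose iterated brackets with `n` elements of `B` vanish. -/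
def IsCoeffLT : ℕ → Module.End (ZMod p) (MvPolynomial (Fin r) B) → Prop
  | 0, φ => φ = 0
  | n + 1, φ => ∀ u : B, IsCoeffLT n (bracket φ (C u))

theorem IsCoeffLT.bracket {n : ℕ} {φ : Module.End (ZMod p) (MvPolynomial (Fin r) B)}
    (h : IsCoeffLT n φ) (x : MvPolynomial (Fin r) B) : IsCoeffLT n (bracket φ x) := by
  induction n generalizing φ with
  | zero => rw [show φ = 0 from h, bracket_zero]; rfl
  | succ n ih => intro u; rw [bracket_bracket]; exact ih (h u)

theorem isDiffOpLT_succ_of_generators {n : ℕ}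
    {φ : Module.End (ZMod p) (MvPolynomial (Fin r) B)}
    (hC : ∀ u : B, IsDiffOpLT n (BSTheory.bracket φ (C u)))
    (hX : ∀ i, IsDiffOpLT n (BSTheory.bracket φ (X i))) : IsDiffOpLT (n + 1) φ := by
  intro q
  induction q using MvPolynomial.induction_on with
  | C u => exact hC u
  | add q q' h h' =>
    have : BSTheory.bracket φ (q + q') = BSTheory.bracket φ q + BSTheory.bracket φ q' := by
      refine LinearMap.ext fun z => ?_
      simp only [bracket_apply, LinearMap.add_apply, add_mul, map_add]; ring
    rw [this]; exact h.add h'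
  | mul_X q i h =>
    have : BSTheory.bracket φ (q * X i) =
        BSTheory.bracket φ q * LinearMap.mulLeft (ZMod p) (X i) +
          LinearMap.mulLeft (ZMod p) q * BSTheory.bracket φ (X i) := by
      refine LinearMap.ext fun z => ?_
      simp only [bracket_apply, LinearMap.add_apply, Module.End.mul_apply,
        LinearMap.mulLeft_apply, mul_assoc]; ring
    rw [this]; exact (h.mul_mulLeft _).add ((hX i).mulLeft_mul _)

theorem isDiffOpLT_of_isCoeffLT (N n : ℕ) (c : Fin r → ℕ) (hN : n + ∑ i, c i ≤ N)
    {φ : Module.End (ZMod p) (MvPolynomial (Fin r) B)} (h : IsCoeffLT n φ)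
    (hX : ∀ i, (bracketHom (X i) ^ c i) φ = 0) : IsDiffOpLT N φ := by
  induction N generalizing n c φ with
  | zero =>
    obtain rfl : n = 0 := by omega
    exact h
  | succ N ih =>
    apply isDiffOpLT_succ_of_generators
    · intro u
      rcases n with _ | n
      · rw [show φ = 0 from h, bracket_zero]; exact IsDiffOpLT.zero _
      · refine ih n c (by omega) (h u) fun i => ?_
        have hcomm : Commute (bracketHom (k := ZMod p) (C u : MvPolynomial (Fin r) B))
            (bracketHom (X i)) := by
          refine LinearMap.ext fun T => ?_
          simp only [Module.End.mul_apply, bracketHom_apply]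
          exact bracket_bracket _ _ _
        have := LinearMap.congr_fun (hcomm.pow_right (c i)).eq φ
        rw [Module.End.mul_apply, Module.End.mul_apply, hX, map_zero, bracketHom_apply] at this
        exact this.symm
    · intro i
      rcases hci : c i with _ | d
      · have h0 : φ = 0 := by simpa [hci] using hX i
        rw [h0, bracket_zero]; exact IsDiffOpLT.zero _
      · refine ih n (Function.update c i d) ?_ (h.bracket _) fun j => ?_
        · have h1 := Finset.add_sum_erase Finset.univ c (Finset.mem_univ i)
          have h2 := Finset.add_sum_erase Finset.univ (Function.update c i d) (Finset.mem_univ i)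
          have h3 : ∑ x ∈ Finset.univ.erase i, Function.update c i d x =
              ∑ x ∈ Finset.univ.erase i, c x :=
            Finset.sum_congr rfl fun j hj => Function.update_of_ne (Finset.ne_of_mem_erase hj) _ _
          rw [Function.update_self, h3] at h2
          omega
        · by_cases hji : j = i
          · subst hji
            rw [Function.update_self, ← bracketHom_apply, ← Module.End.mul_apply, ← pow_succ,
              ← hci]
            exact hX j
          · rw [Function.update_of_ne hji]
            have hcomm : Commute
                (bracketHom (k := ZMod p) (X i : MvPolynomial (Fin r) B))
                (bracketHom (X j)) := by
              refine LinearMap.ext fun T => ?_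
              simp only [Module.End.mul_apply, bracketHom_apply]
              exact bracket_bracket _ _ _
            have := LinearMap.congr_fun (hcomm.pow_right (c j)).eq φ
            rw [Module.End.mul_apply, Module.End.mul_apply, hX, map_zero, bracketHom_apply]
              at this
            exact this.symm

/-- A continuous function to a discrete space only depends on its argument modulo some `p ^ e`. -/
theorem exists_period {T : Type*} (P : CZp p r T) :
    ∃ e : ℕ, ∀ x y : Fin r → ℤ_[p], P (fun i => x i + (p : ℤ_[p]) ^ e * y i) = P x := by
  obtain ⟨δ, hδ, hP⟩ := lebesgue_number_lemma_of_metric (s := Set.univ)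
    (c := fun t : T => P ⁻¹' {t}) (isCompact_univ (X := Fin r → ℤ_[p]))
    (fun t => P.isLocallyConstant {t}) (fun x _ => Set.mem_iUnion.2 ⟨P x, rfl⟩)
  have hp1 : (1 : ℝ) < p := by exact_mod_cast (Fact.out : p.Prime).one_lt
  obtain ⟨e, he⟩ := exists_pow_lt_of_lt_one hδ (inv_lt_one_of_one_lt₀ hp1)
  refine ⟨e, fun x y => ?_⟩
  obtain ⟨t, ht⟩ := hP x (Set.mem_univ _)
  have hx : P x = t := ht (Metric.mem_ball_self hδ)
  rw [hx]
  apply ht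
  rw [Metric.mem_ball, dist_pi_lt_iff hδ]
  intro i
  rw [dist_eq_norm, add_sub_cancel_left, norm_mul, norm_pow, PadicInt.norm_p]
  calc _ ≤ ((p : ℝ)⁻¹) ^ e * 1 := by
        gcongr
        exact PadicInt.norm_le_one _
    _ < δ := by simpa using he

theorem exists_bound (P : CZp p r (DiffOp (ZMod p) B)) :
    ∃ n, ∀ x, IsDiffOpLT n (P x : Module.End (ZMod p) B) := by
  choose n hn using fun φ : DiffOp (ZMod p) B => DiffOp.exists_lt φ
  have hfin : (Set.range P).Finite := P.range_finite
  refine ⟨hfin.toFinset.sup n, fun x => (hn (P x)).mono (Finset.le_sup ?_)⟩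
  simp

/-- The commutator of a family of operators with a constant. -/
def CZp.bracket (P : CZp p r (DiffOp (ZMod p) B)) (u : B) : CZp p r (DiffOp (ZMod p) B) :=
  P * LocallyConstant.const _ (DiffOp.ofMul (ZMod p) u) -
    LocallyConstant.const _ (DiffOp.ofMul (ZMod p) u) * P

theorem CZp.bracket_apply (P : CZp p r (DiffOp (ZMod p) B)) (u : B) (x : Fin r → ℤ_[p]) :
    (P.bracket u x : Module.End (ZMod p) B) = BSTheory.bracket (P x : Module.End (ZMod p) B) u :=
  rfl

theorem bracket_deltaOp_C (P : CZp p r (DiffOp (ZMod p) B)) (u : B) :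
    BSTheory.bracket (deltaOp P) (C u) = deltaOp (P.bracket u) := by
  refine LinearMap.ext fun q => ?_
  ext a
  rw [BSTheory.bracket_apply, coeff_sub, coeff_C_mul, coeff_deltaOp, coeff_deltaOp, coeff_deltaOp,
    coeff_C_mul, CZp.bracket_apply, BSTheory.bracket_apply]

theorem isCoeffLT_deltaOp (n : ℕ) (P : CZp p r (DiffOp (ZMod p) B))
    (h : ∀ x, IsDiffOpLT n (P x : Module.End (ZMod p) B)) : IsCoeffLT n (deltaOp P) := by
  induction n generalizing P with
  | zero =>
    refine LinearMap.ext fun q => ?_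
    ext a
    rw [coeff_deltaOp, show (P (negSubOne p a) : Module.End (ZMod p) B) = 0 from h _]
    simp
  | succ n ih =>
    intro u
    rw [bracket_deltaOp_C]
    exact ih _ fun x => h x u

theorem bracket_deltaOp_X_pow (P : CZp p r (DiffOp (ZMod p) B)) {e : ℕ}
    (he : ∀ x y : Fin r → ℤ_[p], P (fun i => x i + (p : ℤ_[p]) ^ e * y i) = P x) (i : Fin r) :
    BSTheory.bracket (deltaOp P) (X i ^ p ^ e) = 0 := by
  refine LinearMap.ext fun q => ?_
  rw [BSTheory.bracket_apply, LinearMap.zero_apply, sub_eq_zero]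
  induction q using MvPolynomial.induction_on' with
  | add q q' h h' => rw [mul_add, map_add, h, h', map_add, mul_add]
  | monomial a u =>
    rw [X_pow_eq_monomial, monomial_mul, one_mul, deltaOp_monomial, deltaOp_monomial,
      monomial_mul, one_mul]
    congr 3
    have := he (negSubOne p (Finsupp.single i (p ^ e) + a)) (Pi.single i 1)
    rw [← this]
    congr 1
    funext j
    by_cases hj : j = i
    · subst hj; simp [negSubOne]; ring
    · simp [negSubOne, hj, Finsupp.single_eq_of_ne hj]

theorem deltaOp_mem (P : CZp p r (DiffOp (ZMod p) B)) :
    deltaOp P ∈ DiffOp (ZMod p) (MvPolynomial (Fin r) B) := by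
  obtain ⟨n, hn⟩ := exists_bound P
  obtain ⟨e, he⟩ := exists_period P
  refine ⟨n + ∑ _i : Fin r, p ^ e, (isDiffOp_iff_lt _ _).2 (IsDiffOpLT.succ ?_)⟩
  refine isDiffOpLT_of_isCoeffLT _ n (fun _ => p ^ e) le_rfl (isCoeffLT_deltaOp n P hn) fun i => ?_
  rw [bracketHom_pow_char, bracketHom_apply, bracket_deltaOp_X_pow P he]

/-- The ring homomorphism `Δ : C(ℤ_p ^ r, D_B) → D_{B[t_1, …, t_r]}` with
`Δ(P)(u t^a) = P(-a - 1)(u) t^a`. -/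
def Delta : CZp p r (DiffOp (ZMod p) B) →+* DiffOp (ZMod p) (MvPolynomial (Fin r) B) where
  toFun P := ⟨deltaOp P, deltaOp_mem P⟩
  map_one' := by
    refine Subtype.ext (LinearMap.ext fun q => MvPolynomial.ext _ _ fun a => ?_)
    exact coeff_deltaOp _ _ _
  map_mul' P Q := by
    refine Subtype.ext (LinearMap.ext fun q => MvPolynomial.ext _ _ fun a => ?_)
    change coeff a (deltaOp (P * Q) q) = coeff a (deltaOp P (deltaOp Q q))
    rw [coeff_deltaOp, coeff_deltaOp, coeff_deltaOp]
    rfl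
  map_zero' := by
    refine Subtype.ext (LinearMap.ext fun q => MvPolynomial.ext _ _ fun a => ?_)
    exact coeff_deltaOp _ _ _
  map_add' P Q := by
    refine Subtype.ext (LinearMap.ext fun q => MvPolynomial.ext _ _ fun a => ?_)
    change coeff a (deltaOp (P + Q) q) = coeff a (deltaOp P q + deltaOp Q q)
    rw [coeff_add, coeff_deltaOp, coeff_deltaOp, coeff_deltaOp]
    rfl

end Delta

/-! ### The modules attached to `f_1, …, f_r` -/

section Main

variable {R : Type*} [CommRing R] {r : ℕ}

/-- The localization `R_f` with `f = f_1 ⋯ f_r`. -/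
abbrev Rf (f : Fin r → R) : Type _ := Localization.Away (∏ i, f i)

/-- `f_i` as a unit of `R_f`. -/
def fUnit (f : Fin r → R) (i : Fin r) : (Rf f)ˣ :=
  (isUnit_of_dvd_unit (map_dvd (algebraMap R (Rf f)) (Finset.dvd_prod_of_mem f (Finset.mem_univ i)))
    (IsLocalization.Away.algebraMap_isUnit (∏ i, f i))).unit

/-- `f^a = f_1^{a_1} ⋯ f_r^{a_r} ∈ R_f` for `a ∈ ℤ^r`. -/
def fPow (f : Fin r → R) (a : Fin r → ℤ) : Rf f := ((∏ i, fUnit f i ^ a i : (Rf f)ˣ) : Rf f)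

variable (p : ℕ) [Fact p.Prime]

/-- The free rank one `C(ℤ_p ^ r, R_f)`-module `C(ℤ_p ^ r, R_f) f_1^{s_1} ⋯ f_r^{s_r}`. -/
def FsModule (f : Fin r → R) : Type _ := CZp p r (Rf f)

instance (f : Fin r → R) : AddCommGroup (FsModule p f) :=
  inferInstanceAs (AddCommGroup (CZp p r (Rf f)))

instance (f : Fin r → R) : Module (CZp p r (Rf f)) (FsModule p f) :=
  inferInstanceAs (Module (CZp p r (Rf f)) (CZp p r (Rf f)))

/-- The generator `f_1^{s_1} ⋯ f_r^{s_r}`. -/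
def fs (f : Fin r → R) : FsModule p f := (1 : CZp p r (Rf f))

/-- The exponent specialization `E_a : U f_1^{s_1} ⋯ f_r^{s_r} ↦ U(a) f^a`, for `a ∈ ℤ^r`. -/
def expSpec (f : Fin r → R) (a : Fin r → ℤ) : FsModule p f →+ Rf f :=
  (AddMonoidHom.mulRight (fPow f a)).comp
    (LocallyConstant.evalRingHom (fun i => (a i : ℤ_[p])) : CZp p r (Rf f) →+* Rf f).toAddMonoidHom

theorem expSpec_smul_fs (f : Fin r → R) (a : Fin r → ℤ) (U : CZp p r (Rf f)) :
    expSpec p f a (U • fs p f) = U (fun i => (a i : ℤ_[p])) * fPow f a :=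
  congrArg (fun V : CZp p r (Rf f) => V (fun i => (a i : ℤ_[p])) * fPow f a) (mul_one U)

variable [Algebra (ZMod p) R]

/-- The inclusion `C(ℤ_p ^ r, R_f) ⊆ C(ℤ_p ^ r, D_{R_f})`. -/
def inclD (f : Fin r → R) : CZp p r (Rf f) →+* CZp p r (DiffOp (ZMod p) (Rf f)) :=
  LocallyConstant.mapRingHom (DiffOp.ofMul (ZMod p))

/-- The generators `f_i - t_i` of the ideal of the graph, in `R_f[t_1, …, t_r]`. -/
def graphGen (f : Fin r → R) (i : Fin r) : MvPolynomial (Fin r) (Rf f) :=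
  MvPolynomial.C (algebraMap R (Rf f) (f i)) - MvPolynomial.X i

/-- `H' = H^r_{(f_1 - t_1, …, f_r - t_r)} R_f[t_1, …, t_r]`. -/
abbrev HPrime (f : Fin r → R) : Type _ := TopLocCoh (graphGen f)

/-- The `C(ℤ_p ^ r, D_{R_f})`-module structure on `H'`: restriction of the `D_{R_f[t]}`-module
structure along `Δ`. -/
instance (f : Fin r → R) : Module (CZp p r (DiffOp (ZMod p) (Rf f))) (HPrime f) :=
  Module.compHom _ (Delta (p := p) (r := r) (B := Rf f))

theorem czp_smul_def (f : Fin r → R) (P : CZp p r (DiffOp (ZMod p) (Rf f))) (x : HPrime f) :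
    P • x = Delta P • x :=
  rfl

end Main

end BSTheory

end

/-! Write `u_i` for the unit `f_i` of `B = R_f`, `g_i = u_i - t_i`, `g = ∏ g_i` and `q = p ^ e`.
Since `1 / g = g ^ (q - 1) / g ^ q`, an operator `φ` of level `e` sends `δ'` to the class of `φ (g ^
(q - 1)) / g ^ q`. In characteristic `p`, `g_i ^ q = u_i ^ q - t_i ^ q`, so `g_i ^ (q - 1)` is the
geometric sum of the `u_i ^ (q - 1 - a) t_i ^ a` over `a < q`. Hence the numerator of `Δ(W) δ'` is
the sum over the box `0 ≤ b_i < q` of `W(-b - 1)(u ^ (q - 1 - b)) t ^ b`.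

Modulo the ideal `(g_1 ^ q, …, g_r ^ q)` every polynomial has exactly one representative supported
in that box: replacing `t_i ^ q` by `u_i ^ q` gives existence, and `eq_zero_of_mem_span_pow` gives
uniqueness. For a function `U` of period `q`, the numerator has coefficients `U(-b - 1)` times
units, and the `-b - 1` represent each residue class modulo `q` once. So `Θ` matches functions of
period `q` with box numerators over `g ^ q`, which makes it bijective.

The module structure is transported along `Θ`. Compatibility with specializations then amounts to
`apply_zpow_eq_zero_of_Delta_smul_delta`: if `Δ(W) δ' = 0` then `W(a)(u ^ a) = 0` for every integral
`a`. The box coefficients vanish, and for large `e` the monomial `u ^ a` is a `q`-th power times `u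
^ (q - 1 - b)` with `b ≡ -a - 1` modulo `q`; `W(a)` is linear over `q`-th powers. -/

noncomputable section

namespace BSTheory

open MvPolynomial

/-! ### Powers of the graph generators in characteristic `p`. -/

section Graph

variable {p : ℕ} [Fact p.Prime] {r : ℕ} {B : Type*} [CommRing B]

/-- The generators `u_i - t_i` of the ideal of a point `u` of the torus, in `B[t_1, …, t_r]`. -/
def unitGen (u : Fin r → Bˣ) (i : Fin r) : MvPolynomial (Fin r) B := C (u i : B) - X i

/-- The substitution `t_j ↦ u_j - t_j` is an involution exchanging the variable `t_i` with `g_i`, so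
regularity of a variable carries over. -/
theorem isRegular_unitGen (u : Fin r → Bˣ) (i : Fin r) : IsRegular (unitGen u i) := by
  have hσ : ∀ x, aeval (unitGen u) (aeval (unitGen u) x) = x := fun x => by
    have : (aeval (unitGen u)).comp (aeval (unitGen u)) =
        AlgHom.id B (MvPolynomial (Fin r) B) := by
      ext j : 1
      have hC : aeval (unitGen u) (C (u j : B)) = C (u j : B) := aeval_C _ _
      have hj : unitGen u j = C (u j : B) - X j := rfl
      rw [AlgHom.comp_apply, aeval_X, AlgHom.id_apply, hj, map_sub, hC, aeval_X, hj,
        sub_sub_cancel]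
    exact DFunLike.congr_fun this x
  have hleft : IsLeftRegular (unitGen u i) := by
    intro x y h
    have h' := congrArg (aeval (unitGen u)) h
    rw [← aeval_X (R := B) (unitGen u) i] at h'
    simp only [map_mul, hσ] at h'
    rw [← hσ x, ← hσ y, isRegular_X.left h']
  exact ⟨hleft, fun x y h => hleft (by simpa only [mul_comm] using h)⟩

theorem isRegular_prod_unitGen (u : Fin r → Bˣ) : IsRegular (∏ i, unitGen u i) :=
  IsRegular.prod fun i _ => isRegular_unitGen u i

variable [CharP B p]

theorem unitGen_pow_char_pow (u : Fin r → Bˣ) (i : Fin r) (e : ℕ) :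
    unitGen u i ^ p ^ e = C ((u i : B) ^ p ^ e) - X i ^ p ^ e := by
  rw [unitGen, sub_pow_char_pow, C_pow]

/-- Multiplied by the regular element `u_i - t_i`, both sides become `u_i ^ p ^ e - t_i ^ p ^ e`:
Frobenius on the left, a geometric sum on the right. -/
theorem unitGen_pow_char_pow_sub_one (u : Fin r → Bˣ) (i : Fin r) (e : ℕ) :
    unitGen u i ^ (p ^ e - 1) =
      ∑ a ∈ Finset.range (p ^ e), C ((u i : B) ^ (p ^ e - 1 - a)) * X i ^ a := by
  apply (isRegular_unitGen u i).right
  have hpos : 0 < p ^ e := Nat.pow_pos (Fact.out : p.Prime).pos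
  have h := (Commute.all (X i) (C (u i : B))).geom_sum₂_mul (p ^ e)
  simp only
  rw [← pow_succ, Nat.sub_add_cancel hpos, unitGen_pow_char_pow, C_pow]
  rw [← neg_sub, ← h, unitGen, ← neg_sub (X i) (C (u i : B)), mul_neg]
  congr 2
  exact Finset.sum_congr rfl fun a _ => by rw [C_pow, mul_comm]

theorem coeff_prod_unitGen_pow (u : Fin r → Bˣ) (e : ℕ) (b : Fin r →₀ ℕ) :
    coeff b ((∏ i, unitGen u i) ^ (p ^ e - 1)) =
      if ∀ i, b i < p ^ e then ∏ i, (u i : B) ^ (p ^ e - 1 - b i) else 0 := by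
  classical
  rw [← Finset.prod_pow, Finset.prod_congr rfl fun i _ => unitGen_pow_char_pow_sub_one u i e,
    Finset.prod_univ_sum]
  have hmon : ∀ a : Fin r → ℕ,
      ∏ i, (C ((u i : B) ^ (p ^ e - 1 - a i)) * X i ^ a i : MvPolynomial (Fin r) B) =
        monomial (Finsupp.equivFunOnFinite.symm a) (∏ i, (u i : B) ^ (p ^ e - 1 - a i)) := by
    intro a
    rw [Finset.prod_mul_distrib, ← map_prod, monomial_eq, Finsupp.prod_fintype _ _ (by simp)]
    rfl
  simp only [hmon, coeff_sum, coeff_monomial]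
  have hb : ∀ a : Fin r → ℕ, (Finsupp.equivFunOnFinite.symm a = b) ↔ a = ⇑b := fun a => by
    rw [Equiv.symm_apply_eq]; rfl
  simp only [hb, Finset.sum_ite_eq', Fintype.mem_piFinset, Finset.mem_range]

end Graph

/-! ### Linearity of `Δ(U)` over `p ^ e`-th powers. -/

section Level

variable {p : ℕ} [Fact p.Prime] {r : ℕ} {B : Type*} [CommRing B] [Algebra (ZMod p) B]

theorem deltaOp_X_pow_mul (P : CZp p r (DiffOp (ZMod p) B)) {e : ℕ}
    (he : ∀ x y : Fin r → ℤ_[p], P (fun i => x i + (p : ℤ_[p]) ^ e * y i) = P x) (i : Fin r)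
    (z : MvPolynomial (Fin r) B) : deltaOp P (X i ^ p ^ e * z) = X i ^ p ^ e * deltaOp P z := by
  have := LinearMap.congr_fun (bracket_deltaOp_X_pow P he i) z
  rwa [bracket_apply, LinearMap.zero_apply, sub_eq_zero] at this

/-- The inclusion of the multiplication operators in `C(ℤ_p ^ r, D_B)`. -/
def CZp.mulOp : CZp p r B →+* CZp p r (DiffOp (ZMod p) B) :=
  LocallyConstant.mapRingHom (DiffOp.ofMul (ZMod p))

theorem CZp.mulOp_apply (U : CZp p r B) (x : Fin r → ℤ_[p]) (b : B) :
    (CZp.mulOp U x : Module.End (ZMod p) B) b = U x * b :=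
  rfl

theorem CZp.mulOp_period (U : CZp p r B) {e : ℕ}
    (he : ∀ x y : Fin r → ℤ_[p], U (fun i => x i + (p : ℤ_[p]) ^ e * y i) = U x)
    (x y : Fin r → ℤ_[p]) :
    CZp.mulOp U (fun i => x i + (p : ℤ_[p]) ^ e * y i) = CZp.mulOp U x :=
  congrArg (DiffOp.ofMul (ZMod p)) (he x y)

theorem deltaOp_mulOp_C_mul (U : CZp p r B) (c : B) (z : MvPolynomial (Fin r) B) :
    deltaOp (CZp.mulOp U) (C c * z) = C c * deltaOp (CZp.mulOp U) z := by
  ext b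
  simp only [coeff_deltaOp, coeff_C_mul, CZp.mulOp_apply, mul_left_comm]

/-- Taking `p ^ e`-th powers is additive, so constants and variables suffice. Constants commute with
a multiplication operator, and `t_i ^ p ^ e` shifts exponents by a period of `U`. -/
theorem isLevel_deltaOp_mulOp [CharP B p] (U : CZp p r B) {e : ℕ}
    (he : ∀ x y : Fin r → ℤ_[p], U (fun i => x i + (p : ℤ_[p]) ^ e * y i) = U x) :
    IsLevel e (deltaOp (CZp.mulOp U)) := by
  intro x
  induction x using MvPolynomial.induction_on with
  | C c => intro z; rw [← C_pow, deltaOp_mulOp_C_mul]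
  | add x y hx hy => intro z; rw [add_pow_char_pow, add_mul, map_add, hx, hy, add_mul]
  | mul_X x i hx =>
    intro z
    rw [mul_pow, mul_assoc, hx, deltaOp_X_pow_mul _ (CZp.mulOp_period U he), mul_assoc]

end Level

/-! ### Indicator functions of residue classes in `ℤ_p ^ r`. -/

section Residue

variable {p : ℕ} [Fact p.Prime] {r : ℕ} {B : Type*} [CommRing B]

/-- The indicator function of a residue class modulo `p ^ e`, times a constant. -/
def residueIndicator (p : ℕ) [Fact p.Prime] {r : ℕ} {B : Type*} [CommRing B] (e : ℕ)
    (c : Fin r → ℤ_[p]) (v : B) : CZp p r B where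
  toFun x := open Classical in
    if ∀ i, PadicInt.toZModPow e (x i) = PadicInt.toZModPow e (c i) then v else 0
  isLocallyConstant := by
    rw [IsLocallyConstant.iff_eventually_eq]
    intro x
    have hx : ∀ i, ∀ᶠ y : Fin r → ℤ_[p] in nhds x,
        PadicInt.toZModPow e (y i) = PadicInt.toZModPow e (x i) := by
      intro i
      have hpos : (0 : ℝ) < (p : ℝ) ^ (-(e : ℤ)) :=
        zpow_pos (by exact_mod_cast (Fact.out : p.Prime).pos) _
      filter_upwards [(continuous_apply i).continuousAt.preimage_mem_nhds
        (Metric.ball_mem_nhds (x i) hpos)] with y hy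
      -- Two points at distance at most `p ^ (-e)` differ by an element of `p ^ e ℤ_p`, the kernel
      -- of reduction.
      rw [← sub_eq_zero, ← map_sub, ← RingHom.mem_ker, PadicInt.ker_toZModPow,
        ← PadicInt.norm_le_pow_iff_mem_span_pow, ← dist_eq_norm]
      exact (Metric.mem_ball.1 hy).le
    filter_upwards [Filter.eventually_all.2 hx] with y hy
    simp only [hy]

open Classical in
theorem residueIndicator_apply (e : ℕ) (c : Fin r → ℤ_[p]) (v : B) (x : Fin r → ℤ_[p]) :
    residueIndicator p e c v x =
      if ∀ i, PadicInt.toZModPow e (x i) = PadicInt.toZModPow e (c i) then v else 0 :=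
  rfl

theorem residueIndicator_period (e : ℕ) (c : Fin r → ℤ_[p]) (v : B) (x y : Fin r → ℤ_[p]) :
    residueIndicator p e c v (fun i => x i + (p : ℤ_[p]) ^ e * y i) =
      residueIndicator p e c v x := by
  have h : PadicInt.toZModPow e ((p : ℤ_[p]) ^ e) = 0 := by
    rw [← RingHom.mem_ker, PadicInt.ker_toZModPow]
    exact Ideal.mem_span_singleton_self _
  simp only [residueIndicator_apply, map_add, map_mul, h, zero_mul, add_zero]

open Classical in
-- Distinct points of the box remain distinct modulo `p ^ e`. Through `Δ`, such an indicator
-- therefore isolates a single coefficient of a polynomial supported in the box.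
theorem residueIndicator_negSubOne {e : ℕ} {a b : Fin r →₀ ℕ} (ha : ∀ i, a i < p ^ e)
    (hb : ∀ i, b i < p ^ e) (v : B) :
    residueIndicator p e (negSubOne p b) v (negSubOne p a) = if a = b then v else 0 := by
  rw [residueIndicator_apply]
  refine if_congr ⟨fun h => ?_, fun h => by simp [h]⟩ rfl rfl
  ext i
  have := h i
  simp only [negSubOne, map_sub, map_neg, map_one, map_natCast, sub_left_inj, neg_inj] at this
  rw [ZMod.natCast_eq_natCast_iff] at this
  exact Nat.ModEq.eq_of_lt_of_lt this (ha i) (hb i)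

end Residue

/-! ### Vanishing of classes in top local cohomology. -/

section Cech

variable {A : Type*} [CommRing A] {r : ℕ}

/-- Having every large exponent available allows `n = p ^ e` to be chosen later, with `e` also
adapted to a level and a period. -/
theorem exists_pow_mul_eq_of_mem_cechImage (g : Fin r → A) {y : Localization.Away (∏ j, g j)}
    (hy : y ∈ cechImage g) : ∃ N, ∀ n ≥ N, ∃ z ∈ Ideal.span (Set.range fun i => g i ^ n),
      algebraMap A _ ((∏ j, g j) ^ n) * y = algebraMap A _ z := by
  induction hy using Submodule.iSup_induction' with
  | zero => exact ⟨0, fun n _ => ⟨0, zero_mem _, by simp⟩⟩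
  | add y z _ _ hy hz =>
    obtain ⟨N, hN⟩ := hy
    obtain ⟨M, hM⟩ := hz
    refine ⟨max N M, fun n hn => ?_⟩
    obtain ⟨a, ha, hay⟩ := hN n (le_trans (le_max_left _ _) hn)
    obtain ⟨b, hb, hbz⟩ := hM n (le_trans (le_max_right _ _) hn)
    exact ⟨a + b, add_mem ha hb, by rw [mul_add, hay, hbz, map_add]⟩
  | mem i y hy =>
    obtain ⟨w, rfl⟩ := hy
    obtain ⟨N, x, hx⟩ := IsLocalization.Away.surj (∏ j ∈ Finset.univ.erase i, g j) w
    -- An element of the `i`-th localization needs no power of `g_i` in its denominator, so clearing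
    -- it with the full product leaves the factor `g_i ^ n`.
    refine ⟨N, fun n hn => ⟨(∏ j ∈ Finset.univ.erase i, g j) ^ (n - N) * x * g i ^ n,
      Ideal.mul_mem_left _ _ (Ideal.subset_span ⟨i, rfl⟩), ?_⟩⟩
    have h := congrArg (cechMap g i) hx
    rw [← map_pow, map_mul, AlgHom.commutes, AlgHom.commutes] at h
    have hpow : (∏ j, g j) ^ n = (∏ j ∈ Finset.univ.erase i, g j) ^ (n - N) *
        (∏ j ∈ Finset.univ.erase i, g j) ^ N * g i ^ n := by
      rw [← pow_add, Nat.sub_add_cancel hn, ← mul_pow, Finset.prod_erase_mul _ _ (Finset.mem_univ i)]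
    rw [congrArg (algebraMap A (Localization.Away (∏ j, g j))) hpow, map_mul, map_mul, map_mul,
      map_mul, ← h, AlgHom.toLinearMap_apply]
    ring

theorem mem_cechImage_of_pow_mul_eq (g : Fin r → A) {y : Localization.Away (∏ j, g j)} {n : ℕ}
    {z : A} (hz : z ∈ Ideal.span (Set.range fun i => g i ^ n))
    (h : algebraMap A _ ((∏ j, g j) ^ n) * y = algebraMap A _ z) : y ∈ cechImage g := by
  have hu : IsUnit (algebraMap A (Localization.Away (∏ j, g j)) ((∏ j, g j) ^ n)) := by
    rw [map_pow]
    exact (IsLocalization.Away.algebraMap_isUnit (∏ j, g j)).pow n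
  induction hz using Submodule.span_induction generalizing y with
  | zero =>
    rw [map_zero, hu.mul_right_eq_zero] at h
    rw [h]; exact zero_mem _
  | mem z hz =>
    obtain ⟨i, rfl⟩ := hz
    refine Submodule.mem_iSup_of_mem i
      ⟨IsLocalization.Away.invSelf (∏ j ∈ Finset.univ.erase i, g j) ^ n, ?_⟩
    apply hu.mul_left_cancel
    have h' := congrArg (cechMap g i)
      (IsLocalization.Away.mul_invSelf (S := Localization.Away (∏ j ∈ Finset.univ.erase i, g j))
        (∏ j ∈ Finset.univ.erase i, g j))
    rw [map_mul, AlgHom.commutes, map_one] at h'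
    have hpow : (∏ j, g j) ^ n = (∏ j ∈ Finset.univ.erase i, g j) ^ n * g i ^ n := by
      rw [← mul_pow, Finset.prod_erase_mul _ _ (Finset.mem_univ i)]
    rw [h, AlgHom.toLinearMap_apply, congrArg (algebraMap A (Localization.Away (∏ j, g j))) hpow,
      map_mul, map_pow, map_pow (cechMap g i), mul_right_comm, ← mul_pow, h', one_pow, one_mul]
  | add a b _ _ ha hb =>
    -- Division by the unit `g ^ n` splits `y` into a fraction with numerator `a` and one with
    -- numerator `b`.
    obtain ⟨a', ha'⟩ := hu.dvd (a := algebraMap A _ a)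
    have : algebraMap A _ ((∏ j, g j) ^ n) * (y - a') = algebraMap A _ b := by
      rw [mul_sub, h, map_add, ← ha', add_sub_cancel_left]
    rw [← add_sub_cancel a' y]
    exact add_mem (ha ha'.symm) (hb this)
  | smul c a _ ha =>
    obtain ⟨a', ha'⟩ := hu.dvd (a := algebraMap A _ a)
    have : y = c • a' := by
      apply hu.mul_left_cancel
      rw [h, smul_eq_mul, map_mul, ha', Algebra.smul_def, mul_left_comm]
    rw [this]
    exact Submodule.smul_mem _ _ (ha ha'.symm)

variable {p : ℕ} [Fact p.Prime] [Algebra (ZMod p) A]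

theorem pow_mul_extLoc_invSelf (g : Fin r → A) (φ : DiffOp (ZMod p) A) {e : ℕ}
    (he : IsLevel e (φ : Module.End (ZMod p) A)) :
    algebraMap A (Localization.Away (∏ j, g j)) ((∏ j, g j) ^ p ^ e) *
        extLoc (Submonoid.powers (∏ j, g j)) φ (IsLocalization.Away.invSelf (∏ j, g j)) =
      algebraMap A _ ((φ : Module.End (ZMod p) A) ((∏ j, g j) ^ (p ^ e - 1))) := by
  refine extLoc_spec _ φ he (Submonoid.mem_powers _) ?_
  have hpos : 0 < p ^ e := Nat.pow_pos (Fact.out : p.Prime).pos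
  conv_lhs => rw [← Nat.sub_add_cancel hpos, pow_succ, map_mul, mul_assoc,
    IsLocalization.Away.mul_invSelf, mul_one]

end Cech

/-! ### Uniqueness of numerators modulo Frobenius powers of the graph ideal. -/

section Kernel

variable {p : ℕ} [Fact p.Prime] {r : ℕ} {B : Type*} [CommRing B] [Algebra (ZMod p) B]

/-- The product of the generators is regular, so the polynomial ring embeds in its localization and
an equality of numerators there is an equality of polynomials. -/
theorem exists_forall_apply_mem_of_smul_delta_eq_zero (u : Fin r → Bˣ)
    (φ : DiffOp (ZMod p) (MvPolynomial (Fin r) B)) (h : φ • TopLocCoh.delta (unitGen u) = 0) :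
    ∃ N, ∀ e ≥ N, (φ : Module.End (ZMod p) (MvPolynomial (Fin r) B))
      ((∏ i, unitGen u i) ^ (p ^ e - 1)) ∈ Ideal.span (Set.range fun i => unitGen u i ^ p ^ e) := by
  rw [TopLocCoh.delta, TopLocCoh.smul_mk] at h
  obtain ⟨N, hN⟩ := exists_pow_mul_eq_of_mem_cechImage _
    ((Submodule.Quotient.mk_eq_zero _).1 h)
  obtain ⟨d, hd⟩ := DiffOp.exists_level φ
  refine ⟨max N d, fun e he => ?_⟩
  obtain ⟨z, hz, hzy⟩ := hN (p ^ e) ((le_trans (le_max_left _ _) he).trans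
    (Nat.lt_pow_self (Fact.out : p.Prime).one_lt).le)
  rw [pow_mul_extLoc_invSelf _ φ (hd.mono (le_trans (le_max_right _ _) he))] at hzy
  have hinj := IsLocalization.injective (Localization.Away (∏ j, unitGen u j))
    (Submonoid.powers_le.2 (isRegular_prod_unitGen u).mem_nonZeroDivisors)
  rwa [hinj hzy]

variable [CharP B p]

/-- The operator attached to a residue indicator preserves the ideal, being linear over `p ^ e`-th
powers, and cuts `z` down to one monomial `c t ^ b`. The ideal vanishes at the point `t = u`, so `c
u ^ b = 0`, where `u ^ b` is a unit. -/
theorem eq_zero_of_mem_span_pow (u : Fin r → Bˣ) {e : ℕ} {z : MvPolynomial (Fin r) B}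
    (hz : z ∈ Ideal.span (Set.range fun i => unitGen u i ^ p ^ e))
    (hdeg : ∀ b, (∃ i, p ^ e ≤ b i) → coeff b z = 0) : z = 0 := by
  classical
  ext b
  rw [coeff_zero]
  by_cases hb : ∃ i, p ^ e ≤ b i
  · exact hdeg b hb
  push Not at hb
  set V : CZp p r B := residueIndicator p e (negSubOne p b) 1
  have hV := residueIndicator_period (B := B) e (negSubOne p b) 1
  have hmon : deltaOp (CZp.mulOp V) z = monomial b (coeff b z) := by
    ext a
    rw [coeff_deltaOp, CZp.mulOp_apply, coeff_monomial]
    by_cases ha : ∃ i, p ^ e ≤ a i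
    · rw [hdeg a ha, mul_zero, if_neg]
      rintro rfl
      obtain ⟨i, hi⟩ := ha
      exact (hb i).not_ge hi
    push Not at ha
    rw [residueIndicator_negSubOne ha hb]
    by_cases hab : a = b
    · simp [hab]
    · simp [hab, Ne.symm hab]
  -- The operator is not linear over the polynomial ring; the free multiplier `c` lets the span
  -- induction absorb coefficients.
  have heval : ∀ c, eval (fun i => (u i : B)) (deltaOp (CZp.mulOp V) (c * z)) = 0 := by
    clear hmon hdeg
    induction hz using Submodule.span_induction with
    | zero => simp
    | add x y _ _ hx hy => intro c; rw [mul_add, map_add, map_add, hx, hy, add_zero]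
    | mem x hx =>
      obtain ⟨i, rfl⟩ := hx
      intro c
      have hpos : 0 < p ^ e := Nat.pow_pos (Fact.out : p.Prime).pos
      rw [mul_comm, isLevel_deltaOp_mulOp V hV (unitGen u i) c, map_mul, map_pow, unitGen, map_sub,
        eval_C, eval_X, sub_self, zero_pow hpos.ne', zero_mul]
    | smul c x _ hx => intro d; rw [smul_eq_mul, ← mul_assoc]; exact hx _
  replace heval := heval 1
  rw [one_mul] at heval
  rw [hmon, eval_monomial, Finsupp.prod_fintype _ _ (by simp)] at heval
  have hu : IsUnit (∏ i, (u i : B) ^ b i) := ⟨∏ i, u i ^ b i, by simp⟩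
  exact hu.mul_left_eq_zero.1 heval

end Kernel

/-! ### Specialization at integral exponents and bijectivity of `Θ`. -/

section Theta

variable {p : ℕ} [Fact p.Prime] {r : ℕ}

theorem exists_period_forall_ge {T : Type*} (P : CZp p r T) : ∃ N : ℕ, ∀ e ≥ N,
    ∀ x y : Fin r → ℤ_[p], P (fun i => x i + (p : ℤ_[p]) ^ e * y i) = P x := by
  obtain ⟨N, hN⟩ := exists_period P
  refine ⟨N, fun e he x y => ?_⟩
  rw [← hN x fun i => (p : ℤ_[p]) ^ (e - N) * y i]
  simp only [← mul_assoc, ← pow_add, Nat.add_sub_cancel' he]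

variable {B : Type*} [CommRing B] [Algebra (ZMod p) B] [CharP B p]

theorem apply_zpow_eq_zero_of_Delta_smul_delta (u : Fin r → Bˣ) (W : CZp p r (DiffOp (ZMod p) B))
    (h : Delta W • TopLocCoh.delta (unitGen u) = 0) (a : Fin r → ℤ) :
    (W (fun i => (a i : ℤ_[p])) : Module.End (ZMod p) B) ((∏ i, u i ^ a i : Bˣ) : B) = 0 := by
  obtain ⟨N₁, h₁⟩ := exists_forall_apply_mem_of_smul_delta_eq_zero u _ h
  obtain ⟨N₂, h₂⟩ := exists_period_forall_ge W
  obtain ⟨N₃, h₃⟩ := DiffOp.exists_level (W (fun i => (a i : ℤ_[p])))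
  obtain ⟨e, he₁, he₂, he₃⟩ : ∃ e, N₁ ≤ e ∧ N₂ ≤ e ∧ N₃ ≤ e :=
    ⟨max N₁ (max N₂ N₃), by simp, by simp, by simp⟩
  specialize h₁ e he₁
  specialize h₂ e he₂
  replace h₃ := h₃.mono he₃
  have hpos : 0 < p ^ e := Nat.pow_pos (Fact.out : p.Prime).pos
  have hposZ : (0 : ℤ) < (p : ℤ) ^ e := by exact_mod_cast hpos
  -- The box point with `-b - 1 ≡ a` modulo `p ^ e`, so that `W` takes the same value at `a` and at
  -- `-b - 1`.
  set b : Fin r →₀ ℕ :=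
    Finsupp.equivFunOnFinite.symm fun i => ((-a i - 1) % (p : ℤ) ^ e).toNat with hbdef
  have hb : ∀ i, ((b i : ℕ) : ℤ) = (-a i - 1) % (p : ℤ) ^ e := fun i =>
    Int.toNat_of_nonneg (Int.emod_nonneg _ hposZ.ne')
  have hblt : ∀ i, b i < p ^ e := fun i => by
    have := Int.emod_lt_of_pos (-a i - 1) hposZ
    rw [← hb i] at this
    exact_mod_cast this
  have hab : ∀ i, a i = -(b i : ℤ) - 1 - (p : ℤ) ^ e * ((-a i - 1) / (p : ℤ) ^ e) := fun i => by
    have := Int.emod_add_mul_ediv (-a i - 1) ((p : ℤ) ^ e)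
    rw [← hb i] at this
    linarith
  have hW : W (fun i => (a i : ℤ_[p])) = W (negSubOne p b) := by
    rw [← h₂ (negSubOne p b) fun i => -(((-a i - 1) / (p : ℤ) ^ e : ℤ) : ℤ_[p])]
    congr 1
    funext i
    conv_lhs => rw [hab i]
    simp only [negSubOne, Int.cast_sub, Int.cast_neg, Int.cast_mul, Int.cast_pow,
      Int.cast_natCast, Int.cast_one]
    ring
  -- `Δ(W)` acts coefficientwise, so the numerator stays supported in the box.
  have hz := eq_zero_of_mem_span_pow u h₁ fun c hc => by
    change coeff c (deltaOp W _) = 0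
    rw [coeff_deltaOp, coeff_prod_unitGen_pow, if_neg, map_zero]
    intro h
    obtain ⟨i, hi⟩ := hc
    exact (h i).not_ge hi
  have hc : coeff b (deltaOp W ((∏ i, unitGen u i) ^ (p ^ e - 1))) = 0 := by
    rw [← coeff_zero b]; exact congrArg (coeff b) hz
  rw [coeff_deltaOp, coeff_prod_unitGen_pow, if_pos hblt, ← hW] at hc
  -- With `k = (-a - 1) / p ^ e` rounded down, `a = p ^ e (-k - 1) + (p ^ e - 1 - b)`; the first
  -- factor passes through `W(a)` by its level.
  have hfac : ((∏ i, u i ^ a i : Bˣ) : B) =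
      ((∏ i, u i ^ (-((-a i - 1) / (p : ℤ) ^ e) - 1) : Bˣ) : B) ^ p ^ e *
        ∏ i, (u i : B) ^ (p ^ e - 1 - b i) := by
    have hU : (∏ i, u i ^ a i : Bˣ) = (∏ i, u i ^ (-((-a i - 1) / (p : ℤ) ^ e) - 1)) ^ p ^ e *
        ∏ i, u i ^ (p ^ e - 1 - b i) := by
      rw [← Finset.prod_pow, ← Finset.prod_mul_distrib]
      refine Finset.prod_congr rfl fun i _ => ?_
      rw [← zpow_natCast, ← zpow_mul, ← zpow_natCast, ← zpow_add]
      congr 1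
      have h1 : ((p ^ e - 1 - b i : ℕ) : ℤ) = (p : ℤ) ^ e - 1 - b i := by
        have := hblt i
        rw [Nat.cast_sub (by omega), Nat.cast_sub (by omega)]
        push_cast; rfl
      rw [h1]
      conv_lhs => rw [hab i]
      push_cast
      ring
    rw [hU]
    simp
  rw [hfac, h₃, hc, mul_zero]

theorem Delta_mulOp_smul_delta (u : Fin r → Bˣ) (U : CZp p r B) {e : ℕ}
    (he : ∀ x y : Fin r → ℤ_[p], U (fun i => x i + (p : ℤ_[p]) ^ e * y i) = U x)
    {y : Localization.Away (∏ i, unitGen u i)} {z : MvPolynomial (Fin r) B}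
    (hy : algebraMap _ _ ((∏ i, unitGen u i) ^ p ^ e) * y = algebraMap _ _ z)
    (hz : deltaOp (CZp.mulOp U) ((∏ i, unitGen u i) ^ (p ^ e - 1)) - z ∈
      Ideal.span (Set.range fun i => unitGen u i ^ p ^ e)) :
    Delta (CZp.mulOp U) • TopLocCoh.delta (unitGen u) = TopLocCoh.mk (unitGen u) y := by
  rw [TopLocCoh.delta, TopLocCoh.smul_mk]
  refine (Submodule.Quotient.eq _).2 (mem_cechImage_of_pow_mul_eq _ hz ?_)
  rw [mul_sub, hy, pow_mul_extLoc_invSelf _ _ (isLevel_deltaOp_mulOp U he), map_sub]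
  rfl

theorem exists_Delta_mulOp_smul_delta_eq (u : Fin r → Bˣ) (x : TopLocCoh (unitGen u)) :
    ∃ U : CZp p r B, Delta (CZp.mulOp U) • TopLocCoh.delta (unitGen u) = x := by
  classical
  obtain ⟨y, rfl⟩ : ∃ y, TopLocCoh.mk (unitGen u) y = x := Submodule.Quotient.mk_surjective _ x
  obtain ⟨n, z, hz⟩ := IsLocalization.Away.surj (∏ i, unitGen u i) y
  have hpos : 0 < p ^ n := Nat.pow_pos (Fact.out : p.Prime).pos
  have hz' : algebraMap _ _ ((∏ i, unitGen u i) ^ p ^ n) * y =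
      algebraMap _ _ ((∏ i, unitGen u i) ^ (p ^ n - n) * z) := by
    have hn : n ≤ p ^ n := (Nat.lt_pow_self (Fact.out : p.Prime).one_lt).le
    conv_lhs => rw [← Nat.sub_add_cancel hn, pow_add]
    rw [map_mul, map_mul, ← hz, map_pow _ _ n]
    ring
  generalize (∏ i, unitGen u i) ^ (p ^ n - n) * z = w at hz'
  have hu : IsUnit (algebraMap _ (Localization.Away (∏ i, unitGen u i))
      ((∏ i, unitGen u i) ^ p ^ n)) := by
    rw [map_pow]
    exact (IsLocalization.Away.algebraMap_isUnit (∏ j, unitGen u j)).pow _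
  clear hz z
  -- The fraction `y` varies with its numerator, which reduces surjectivity to monomial numerators
  -- over `g ^ p ^ n`.
  induction w using MvPolynomial.induction_on' generalizing y with
  | add w w' h h' =>
    obtain ⟨v, hv⟩ := hu.dvd (a := algebraMap _ _ w)
    obtain ⟨U, hU⟩ := h v hv.symm
    obtain ⟨U', hU'⟩ := h' (y - v) (by rw [mul_sub, hz', map_add, ← hv, add_sub_cancel_left])
    refine ⟨U + U', ?_⟩
    rw [map_add, map_add, add_smul, hU, hU', ← map_add, add_sub_cancel]
  | monomial m c =>
    -- Modulo the `g_i ^ p ^ n`, the monomial `t ^ m` equals `s t ^ b`. The unit `d` is the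
    -- coefficient of `t ^ b` in `g ^ (p ^ n - 1)`, so the indicator of the class of `-b - 1` with
    -- value `c s d⁻¹` produces the numerator `c s t ^ b`.
    set b : Fin r →₀ ℕ := Finsupp.equivFunOnFinite.symm fun i => m i % p ^ n
    have hb : ∀ i, b i = m i % p ^ n := fun i => rfl
    have hblt : ∀ i, b i < p ^ n := fun i => Nat.mod_lt _ hpos
    set d : Bˣ := ∏ i, u i ^ (p ^ n - 1 - b i) with hd
    set s : B := ∏ i, ((u i : B) ^ p ^ n) ^ (m i / p ^ n) with hs
    refine ⟨residueIndicator p n (negSubOne p b) (c * s * (d⁻¹ : Bˣ)),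
      Delta_mulOp_smul_delta u _ (residueIndicator_period _ _ _) hz' ?_⟩
    have hmon : deltaOp (CZp.mulOp (residueIndicator p n (negSubOne p b) (c * s * (d⁻¹ : Bˣ))))
        ((∏ i, unitGen u i) ^ (p ^ n - 1)) = monomial b (c * s) := by
      ext a
      rw [coeff_deltaOp, coeff_prod_unitGen_pow, CZp.mulOp_apply, coeff_monomial]
      by_cases ha : ∀ i, a i < p ^ n
      · rw [if_pos ha, residueIndicator_negSubOne ha hblt]
        by_cases hab : a = b
        · have : (∏ i, (u i : B) ^ (p ^ n - 1 - b i)) = d := by simp [hd]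
          rw [hab, if_pos rfl, if_pos rfl, this, Units.inv_mul_cancel_right]
        · rw [if_neg hab, if_neg (Ne.symm hab), zero_mul]
      · rw [if_neg ha, mul_zero, if_neg]
        rintro rfl
        exact ha hblt
    rw [hmon, ← Ideal.Quotient.eq]
    set I := Ideal.span (Set.range fun i => unitGen u i ^ p ^ n)
    have hX : ∀ i, Ideal.Quotient.mk I (X i) ^ p ^ n = Ideal.Quotient.mk I (C (u i : B)) ^ p ^ n := by
      intro i
      have : unitGen u i ^ p ^ n ∈ I := Ideal.subset_span ⟨i, rfl⟩
      rw [unitGen_pow_char_pow, ← Ideal.Quotient.eq] at this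
      rw [← map_pow, ← map_pow, ← this, C_pow]
    rw [monomial_eq, monomial_eq, Finsupp.prod_fintype _ _ (by simp),
      Finsupp.prod_fintype _ _ (by simp)]
    simp only [hs, map_mul, map_prod, map_pow, mul_assoc]
    rw [← Finset.prod_mul_distrib]
    congr 1
    refine Finset.prod_congr rfl fun i _ => ?_
    rw [← hX, ← pow_mul, ← pow_add, hb, Nat.div_add_mod]

theorem apply_zpow_eq_of_Delta_smul_delta_eq (u : Fin r → Bˣ)
    {W W' : CZp p r (DiffOp (ZMod p) B)}
    (h : Delta W • TopLocCoh.delta (unitGen u) = Delta W' • TopLocCoh.delta (unitGen u))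
    (a : Fin r → ℤ) :
    (W (fun i => (a i : ℤ_[p])) : Module.End (ZMod p) B) ((∏ i, u i ^ a i : Bˣ) : B) =
      (W' (fun i => (a i : ℤ_[p])) : Module.End (ZMod p) B) ((∏ i, u i ^ a i : Bˣ) : B) := by
  rw [← sub_add_cancel W W', map_add, add_smul, add_eq_right] at h
  exact sub_eq_zero.1 (apply_zpow_eq_zero_of_Delta_smul_delta u _ h a)

variable (p) in
/-- The map `U ↦ Δ(U) • δ'`. -/
def deltaSMulHom (u : Fin r → Bˣ) : CZp p r B →+ TopLocCoh (unitGen u) where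
  toFun U := Delta (CZp.mulOp U) • TopLocCoh.delta (unitGen u)
  map_zero' := by rw [map_zero, map_zero, zero_smul]
  map_add' U V := by rw [map_add, map_add, add_smul]

/-- At an integral point, `U(a) u ^ a = 0` forces `U(a) = 0`. Integral points are dense and meet
every fibre of a locally constant function. -/
theorem deltaSMulHom_injective (u : Fin r → Bˣ) : Function.Injective (deltaSMulHom p u) := by
  rw [injective_iff_map_eq_zero]
  intro U hU
  have hdense : DenseRange fun a : Fin r → ℤ => fun i => (a i : ℤ_[p]) :=
    DenseRange.piMap fun _ => PadicInt.denseRange_intCast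
  refine LocallyConstant.ext fun x => ?_
  obtain ⟨a, ha⟩ := hdense.exists_mem_open (U.isLocallyConstant.isOpen_fiber (U x)) ⟨x, rfl⟩
  exact ha.symm.trans ((Units.isUnit _).mul_left_eq_zero.1
    (apply_zpow_eq_zero_of_Delta_smul_delta u _ hU a))

theorem deltaSMulHom_bijective (u : Fin r → Bˣ) : Function.Bijective (deltaSMulHom p u) :=
  ⟨deltaSMulHom_injective u, exists_Delta_mulOp_smul_delta_eq u⟩

end Theta

end BSTheory

end

/-! ### The module structure transported along `Θ`. -/

open BSTheory in
theorem theorem4p3 (p : ℕ) [Fact p.Prime] {R : Type*} [CommRing R] [CharP R p]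
    [Algebra (ZMod p) R] (hR : BSTheory.IsFFinite p R) {r : ℕ} (f : Fin r → R)
    (hf : ∏ i, f i ∈ nonZeroDivisors R) :
    ∃ _ : Module (BSTheory.CZp p r (BSTheory.DiffOp (ZMod p) (BSTheory.Rf f)))
        (BSTheory.FsModule p f),
      (∀ (a : Fin r → ℤ) (P : BSTheory.CZp p r (BSTheory.DiffOp (ZMod p) (BSTheory.Rf f)))
          (U : BSTheory.CZp p r (BSTheory.Rf f)),
        BSTheory.expSpec p f a (P • (U • BSTheory.fs p f)) =
          (P (fun i => (a i : ℤ_[p])) : Module.End (ZMod p) (BSTheory.Rf f))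
            (BSTheory.expSpec p f a (U • BSTheory.fs p f))) ∧
      ∃ Θ : BSTheory.FsModule p f
          ≃ₗ[BSTheory.CZp p r (BSTheory.DiffOp (ZMod p) (BSTheory.Rf f))] BSTheory.HPrime f,
        ∀ U : BSTheory.CZp p r (BSTheory.Rf f),
          Θ (U • BSTheory.fs p f) =
            BSTheory.Delta (BSTheory.inclD p f U) •
              BSTheory.TopLocCoh.delta (BSTheory.graphGen f) := by
  have : Nontrivial R := CharP.nontrivial_of_char_ne_one (Fact.out : p.Prime).ne_one
  -- Since the product of the `f_i` is a non-zero divisor, `R` embeds in `R_f`; a nonzero algebra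
  -- over the field `ZMod p` has characteristic `p`.
  have : Nontrivial (Rf f) := (IsLocalization.injective (Rf f)
    (Submonoid.powers_le.2 hf)).nontrivial
  have : CharP (Rf f) p :=
    charP_of_injective_algebraMap (algebraMap (ZMod p) (Rf f)).injective p
  -- By unfolding, `graphGen f` is `unitGen (fUnit f)`, so the results for units apply directly.
  let Θ : FsModule p f ≃+ HPrime f :=
    AddEquiv.ofBijective (deltaSMulHom p (fUnit f)) (deltaSMulHom_bijective (fUnit f))
  have hΘ : ∀ U : CZp p r (Rf f),
      Θ (U • fs p f) = Delta (inclD p f U) • TopLocCoh.delta (graphGen f) := fun U =>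
    congrArg (deltaSMulHom p (fUnit f)) (mul_one U)
  let inst : Module (CZp p r (DiffOp (ZMod p) (Rf f))) (FsModule p f) := Θ.module _
  have hsmul : ∀ (P : CZp p r (DiffOp (ZMod p) (Rf f))) (U : FsModule p f),
      Θ (P • U) = P • Θ U := fun P U => Θ.apply_symm_apply _
  refine ⟨inst, fun a P U => ?_, { Θ with map_smul' := hsmul }, hΘ⟩
  -- If `P • U f^s = V f^s`, the operators `V` and `P U` agree on `δ'`, hence at `a` on `f ^ a`;
  -- this is the specialization identity.
  have h : Delta (inclD p f (P • (U • fs p f))) • TopLocCoh.delta (graphGen f) =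
      Delta (P * inclD p f U) • TopLocCoh.delta (graphGen f) := by
    rw [map_mul, mul_smul, ← hΘ U]
    exact hsmul P (U • fs p f)
  rw [expSpec_smul_fs]
  exact apply_zpow_eq_of_Delta_smul_delta_eq (fUnit f) h a
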